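/- Let $m,n\ge 1$, let $x_0<\dots<x_m$ and $y_0<\dots<y_n$ be arbitrary knots, $\Omega=[x_0,x_m]\times[y_0,y_n]$, and let every cell $[x_{i-1},x_i]\times[y_{j-1},y_j]$ be cut by its two diagonals (criss-cross triangulation). Add arbitrary auxiliary knots $\bar x_{-2}<\bar x_{-1}<x_0$ and $x_m<\bar x_{m+1}<\bar x_{m+2}$, put $\bar x_i=x_i$ for $0\le i\le m$, $\bar h_i=\bar x_i-\bar x_{i-1}$, $\bar\sigma_i=\bar h_i/(\bar h_{i-1}+\bar h_i)$, $\bar\sigma_i'=1-\bar\sigma_i$, and define $\bar y_j,\bar k_j,\bar\tau_j,\bar\tau_j'$ in the same way in the second direction. *B-splines.* For $0\le i\le m+1$, $0\le j\le n+1$ let $\bar B_{ij}$ be the classical $C^1$ piecewise quadratic B-spline on the extended criss-cross triangulation, supported on the octagon obtained from the $3\times3$ cells centred at $[\bar x_{i-1},\bar x_i]\times[\bar y_{j-1},\bar y_j]$ by cutting off the four outer corners along diagonals. Its Bernstein–Bézier coefficients at the midpoints of the bottom, top, left and right edges of the central cell are $\bar\tau_j',\bar\tau_{j+1},\bar\sigma_i',\bar\sigma_{i+1}$,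 and at all other edge midpoints they are $0$. Its values at the lower-left, lower-right, upper-left and upper-right corners of the central cell are $\bar\sigma_i'\bar\tau_j',\ \bar\sigma_{i+1}\bar\tau_j',\ \bar\sigma_i'\bar\tau_{j+1},\ \bar\sigma_{i+1}\bar\tau_{j+1}$, and at all other grid vertices they are $0$. In each cell the coefficient at the midpoint of a half-diagonal is the mean of those at the midpoints of the two edges meeting at its corner, and the coefficient at the centre is the mean of those at the midpoints of the four edges. The B-splines of $\Omega$ are, on $\Omega$, $$B_{ij}=\sum_{k=0}^{m+1}\sum_{l=0}^{n+1}p_{ik}\,q_{jl}\,\bar B_{kl},$$ where the only non-zero entries of $p$ are $p_{00}=1/\bar\sigma_1$, $p_{m+1,m+1}=1/\bar\sigma'_{m+1}$, $p_{ii}=1$ for $1\le i\le m$, $p_{10}=-\bar\sigma_1'/\bar\sigma_1$, $p_{m,m+1}=-\bar\sigma_{m+1}/\bar\sigma'_{m+1}$, and $q$ is given by the same formulas with $n$ and $\bar\tau$. *Data sites.* Put $x_i=x_0$ for $i<0$, $x_i=x_m$ for $i>m$, $h_i=x_i-x_{i-1}$ (so $h_0=h_{m+1}=0$), $s_i=\frac12(x_{i-1}+x_i)$,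 and $\sigma_i=h_i/(h_{i-1}+h_i)$, $\sigma_i'=h_{i-1}/(h_{i-1}+h_i)$ for $1\le i\le m+1$; define $y_j,k_j,t_j,\tau_j,\tau_j'$ in the same way. Let $M_{ij}=(s_i,t_j)$ and $A^*_{ij}=(x_i,y_j)$. *Quasi-interpolants.* For $1\le i\le m$ let $$a_i=-\frac{\sigma_i^2\sigma_{i+1}'}{\sigma_i+\sigma_{i+1}'},\qquad c_i=-\frac{\sigma_i(\sigma_{i+1}')^2}{\sigma_i+\sigma_{i+1}'},$$ let $a_0=c_0=a_{m+1}=c_{m+1}=0$, define $\bar a_j,\bar c_j$ by the same formulas with $\tau$ and $n$, and let $b_{ij}=1-(a_i+c_i+\bar a_j+\bar c_j)$. Put $$\mu_{ij}(f)=b_{ij}f(M_{ij})+a_if(M_{i-1,j})+c_if(M_{i+1,j})+\bar a_jf(M_{i,j-1})+\bar c_jf(M_{i,j+1}),$$ $$\mu^*_{ij}(f)=2f(M_{ij})-\tfrac14\big[f(A^*_{i-1,j-1})+f(A^*_{i-1,j})+f(A^*_{i,j-1})+f(A^*_{ij})\big],$$ $$S_2f=\sum_{i=0}^{m+1}\sum_{j=0}^{n+1}\mu_{ij}(f)B_{ij},\qquad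 W_2^*f=\sum_{i=0}^{m+1}\sum_{j=0}^{n+1}\mu^*_{ij}(f)B_{ij}.$$ Then: 1. All data sites $M_{ij}$ ($0\le i\le m+1$, $0\le j\le n+1$) and $A^*_{ij}$ ($-1\le i\le m+1$, $-1\le j\le n+1$) lie in $\Omega$. 2. $S_2p=p$ and $W_2^*p=p$ on $\Omega$ for every polynomial $p$ in two variables of total degree at most $2$. 3. $S_2$ and $W_2^*$ are bounded linear operators on $C(\Omega)$ with the supremum norm, and $\|S_2\|_\infty\le 5$, $\|W_2^*\|_\infty\le 3$, for all such knots. -/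

import Mathlib

/-!
A direction of the grid is given by `m : ℕ` and a sequence `x : ℤ → ℝ`, strictly increasing on
`-2, …, m + 2`. The knots of the partition are `x 0 < ⋯ < x m`, and `x (-2) < x (-1) < x 0`,
`x m < x (m + 1) < x (m + 2)` are the additional knots of the extended partition, on which
the classical B-splines live.
-/

noncomputable section

namespace CrissCross

/-! ### Classical B-splines on the extended criss-cross triangulation -/

/-- Step lengths `x i - x (i - 1)` of the extended partition. -/
def barStep (x : ℤ → ℝ) (i : ℤ) : ℝ := x i - x (i - 1)

/-- The ratio `h_i / (h_{i-1} + h_i)` on the extended partition. -/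
def barSigma (x : ℤ → ℝ) (i : ℤ) : ℝ := barStep x i / (barStep x (i - 1) + barStep x i)

/-- The ratio `h_{i-1} / (h_{i-1} + h_i)` on the extended partition. -/
def barSigma' (x : ℤ → ℝ) (i : ℤ) : ℝ := barStep x (i - 1) / (barStep x (i - 1) + barStep x i)

/-- Bernstein–Bézier coefficient of the classical B-spline with index `(i, j)` at the grid vertex
`(x a, y b)`. It vanishes except at the four corners of the central cell
`[x (i-1), x i] × [y (j-1), y j]`. -/
def vertexCoeff (x y : ℤ → ℝ) (i j a b : ℤ) : ℝ :=
  (if a = i - 1 then barSigma' x i else if a = i then barSigma x (i + 1) else 0) *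
  (if b = j - 1 then barSigma' y j else if b = j then barSigma y (j + 1) else 0)

/-- Bernstein–Bézier coefficient of the classical B-spline with index `(i, j)` at the midpoint of
the horizontal edge `[x (a-1), x a] × {y b}`. It vanishes except on the two horizontal edges of
the central cell. -/
def hEdgeCoeff (y : ℤ → ℝ) (i j a b : ℤ) : ℝ :=
  if a = i then
    if b = j - 1 then barSigma' y j else if b = j then barSigma y (j + 1) else 0
  else 0

/-- Bernstein–Bézier coefficient of the classical B-spline with index `(i, j)` at the midpoint of
the vertical edge `{x a} × [y (b-1), y b]`. It vanishes except on the two vertical edges of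
the central cell. -/
def vEdgeCoeff (x : ℤ → ℝ) (i j a b : ℤ) : ℝ :=
  if b = j then
    if a = i - 1 then barSigma' x i else if a = i then barSigma x (i + 1) else 0
  else 0

/-- A piecewise quadratic function on the unit square cut by its two diagonals, in
Bernstein–Bézier form. The corners are `A = (0,0)`, `B = (1,0)`, `C = (1,1)`, `D = (0,1)` and
the centre is `O`. The numbers `α, β, γ, δ, ω` are the barycentric coordinates of `(u, v)` with
respect to `A, B, C, D, O` in whichever of the triangles `ABO`, `BCO`, `CDO`, `DAO` contains it
(the coordinates for the two corners not in that triangle are `0`).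
The coefficients at the corners and at the midpoints of the sides are given; the
ones at the midpoints of the half-diagonals and at the centre are the averages that `C¹` joins
across the diagonals force. -/
def cellValue (cA cB cC cD cAB cBC cCD cDA u v : ℝ) : ℝ :=
  let α := max 0 (1 - u - v)
  let β := max 0 (u - v)
  let γ := max 0 (u + v - 1)
  let δ := max 0 (v - u)
  let ω := 2 * min (min u (1 - u)) (min v (1 - v))
  let cAO := (cAB + cDA) / 2
  let cBO := (cAB + cBC) / 2
  let cCO := (cBC + cCD) / 2
  let cDO := (cCD + cDA) / 2
  let cO := (cAB + cBC + cCD + cDA) / 4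
  α ^ 2 * cA + β ^ 2 * cB + γ ^ 2 * cC + δ ^ 2 * cD + ω ^ 2 * cO
    + 2 * α * β * cAB + 2 * β * γ * cBC + 2 * γ * δ * cCD + 2 * δ * α * cDA
    + 2 * ω * (α * cAO + β * cBO + γ * cCO + δ * cDO)

/-- The classical `C¹` quadratic B-spline with index `(i, j)`, whose support is the octagon
obtained from the `3 × 3` cells around `[x (i-1), x i] × [y (j-1), y j]` by cutting off the four
outer corners along diagonals. It is given cell by cell. -/
def classicalB (x y : ℤ → ℝ) (i j : ℤ) (P : ℝ × ℝ) : ℝ :=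
  ∑ a ∈ Finset.Icc (i - 1) (i + 1), ∑ b ∈ Finset.Icc (j - 1) (j + 1),
    if x (a - 1) ≤ P.1 ∧ P.1 < x a ∧ y (b - 1) ≤ P.2 ∧ P.2 < y b then
      cellValue
        (vertexCoeff x y i j (a - 1) (b - 1)) (vertexCoeff x y i j a (b - 1))
        (vertexCoeff x y i j a b) (vertexCoeff x y i j (a - 1) b)
        (hEdgeCoeff y i j a (b - 1)) (vEdgeCoeff x i j a b)
        (hEdgeCoeff y i j a b) (vEdgeCoeff x i j (a - 1) b)
        ((P.1 - x (a - 1)) / barStep x a) ((P.2 - y (b - 1)) / barStep y b)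
    else 0

/-! ### B-splines of the bounded rectangle -/

/-- The coefficient of the classical B-spline with first index `i'` in the B-spline of the
bounded rectangle with first index `i` (and likewise for the second index):
`B_0 = B̄_0 / σ̄_1`, `B_{m+1} = B̄_{m+1} / σ̄'_{m+1}`, the correction `- (σ̄'_1 / σ̄_1) B̄_0` in `B_1`,
the correction `- (σ̄_{m+1} / σ̄'_{m+1}) B̄_{m+1}` in `B_m`, and `B_i = B̄_i` otherwise. -/
def layerCoeff (m : ℕ) (x : ℤ → ℝ) (i i' : ℤ) : ℝ :=
  if i = 0 then
    if i' = 0 then 1 / barSigma x 1 else 0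
  else if i = m + 1 then
    if i' = m + 1 then 1 / barSigma' x (m + 1) else 0
  else
    (if i' = i then 1 else 0)
      - (if i = 1 ∧ i' = 0 then barSigma' x 1 / barSigma x 1 else 0)
      - (if i = m ∧ i' = m + 1 then barSigma x (m + 1) / barSigma' x (m + 1) else 0)

/-- The B-spline `B_{ij}`, `0 ≤ i ≤ m + 1`, `0 ≤ j ≤ n + 1`, of the rectangle
`[x 0, x m] × [y 0, y n]` (to be evaluated at points of that rectangle). -/
def bspline (m n : ℕ) (x y : ℤ → ℝ) (i j : ℤ) (P : ℝ × ℝ) : ℝ :=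
  ∑ i' ∈ Finset.Icc (0 : ℤ) (m + 1), ∑ j' ∈ Finset.Icc (0 : ℤ) (n + 1),
    layerCoeff m x i i' * layerCoeff n y j j' * classicalB x y i' j' P

/-! ### The rectangle, its multiple knots and the data sites -/

/-- The rectangle `Ω = [x 0, x m] × [y 0, y n]`. -/
abbrev Omega (m n : ℕ) (x y : ℤ → ℝ) : Set (ℝ × ℝ) := Set.Icc (x 0, y 0) (x m, y n)

/-- The knots `x_i` with repeated end knots: `x_i = x_0` for `i ≤ 0` and `x_i = x_m` for `i ≥ m`. -/
def knot (m : ℕ) (x : ℤ → ℝ) (i : ℤ) : ℝ := x (max 0 (min i m))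

/-- `h_i = x_i - x_{i-1}`, so that `h_0 = h_{m+1} = 0`. -/
def step (m : ℕ) (x : ℤ → ℝ) (i : ℤ) : ℝ := knot m x i - knot m x (i - 1)

/-- `s_i = (x_{i-1} + x_i) / 2`, so that `s_0 = x_0` and `s_{m+1} = x_m`. -/
def mid (m : ℕ) (x : ℤ → ℝ) (i : ℤ) : ℝ := (knot m x (i - 1) + knot m x i) / 2

/-- `σ_i = h_i / (h_{i-1} + h_i)`, so that `σ_1 = 1` and `σ_{m+1} = 0`. -/
def sigma (m : ℕ) (x : ℤ → ℝ) (i : ℤ) : ℝ := step m x i / (step m x (i - 1) + step m x i)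

/-- `σ'_i = h_{i-1} / (h_{i-1} + h_i)`, so that `σ'_1 = 0` and `σ'_{m+1} = 1`. -/
def sigma' (m : ℕ) (x : ℤ → ℝ) (i : ℤ) : ℝ := step m x (i - 1) / (step m x (i - 1) + step m x i)

/-- The sites `M_{ij} = (s_i, t_j)`. -/
def siteM (m n : ℕ) (x y : ℤ → ℝ) (i j : ℤ) : ℝ × ℝ := (mid m x i, mid n y j)

/-- The sites `A*_{ij} = (x_i, y_j)`, with indices outside the grid moved to its boundary. -/
def siteA (m n : ℕ) (x y : ℤ → ℝ) (i j : ℤ) : ℝ × ℝ := (knot m x i, knot n y j)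

/-! ### The quasi-interpolants -/

/-- `a_i = - σ_i² σ'_{i+1} / (σ_i + σ'_{i+1})`, and `a_0 = a_{m+1} = 0`. -/
def coeffA (m : ℕ) (x : ℤ → ℝ) (i : ℤ) : ℝ :=
  if i = 0 ∨ i = m + 1 then 0
  else -(sigma m x i ^ 2 * sigma' m x (i + 1) / (sigma m x i + sigma' m x (i + 1)))

/-- `c_i = - σ_i (σ'_{i+1})² / (σ_i + σ'_{i+1})`, and `c_0 = c_{m+1} = 0`. -/
def coeffC (m : ℕ) (x : ℤ → ℝ) (i : ℤ) : ℝ :=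
  if i = 0 ∨ i = m + 1 then 0
  else -(sigma m x i * sigma' m x (i + 1) ^ 2 / (sigma m x i + sigma' m x (i + 1)))

/-- `b_{ij} = 1 - (a_i + c_i + ā_j + c̄_j)`. -/
def coeffB (m n : ℕ) (x y : ℤ → ℝ) (i j : ℤ) : ℝ :=
  1 - (coeffA m x i + coeffC m x i + coeffA n y j + coeffC n y j)

/-- The coefficient functionals `μ_{ij}` of `S₂`. -/
def mu (m n : ℕ) (x y : ℤ → ℝ) (i j : ℤ) (f : ℝ × ℝ → ℝ) : ℝ :=
  coeffB m n x y i j * f (siteM m n x y i j)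
    + coeffA m x i * f (siteM m n x y (i - 1) j) + coeffC m x i * f (siteM m n x y (i + 1) j)
    + coeffA n y j * f (siteM m n x y i (j - 1)) + coeffC n y j * f (siteM m n x y i (j + 1))

/-- The coefficient functionals `μ*_{ij}` of `W₂*`. -/
def muStar (m n : ℕ) (x y : ℤ → ℝ) (i j : ℤ) (f : ℝ × ℝ → ℝ) : ℝ :=
  2 * f (siteM m n x y i j)
    - 1 / 4 * (f (siteA m n x y (i - 1) (j - 1)) + f (siteA m n x y (i - 1) j)
      + f (siteA m n x y i (j - 1)) + f (siteA m n x y i j))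

/-- The quasi-interpolant `S₂`. -/
def S2 (m n : ℕ) (x y : ℤ → ℝ) (f : ℝ × ℝ → ℝ) (P : ℝ × ℝ) : ℝ :=
  ∑ i ∈ Finset.Icc (0 : ℤ) (m + 1), ∑ j ∈ Finset.Icc (0 : ℤ) (n + 1),
    mu m n x y i j f * bspline m n x y i j P

/-- The modified Chui–Wang quasi-interpolant `W₂*`. -/
def W2star (m n : ℕ) (x y : ℤ → ℝ) (f : ℝ × ℝ → ℝ) (P : ℝ × ℝ) : ℝ :=
  ∑ i ∈ Finset.Icc (0 : ℤ) (m + 1), ∑ j ∈ Finset.Icc (0 : ℤ) (n + 1),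
    muStar m n x y i j f * bspline m n x y i j P

end CrissCross

end

/-! Everything reduces to Bernstein–Bézier coefficients on one closed cell. There a B-spline of the
rectangle is a quadratic patch whose vertex and edge coefficients are products of one-dimensional
data. The end corrections `layerCoeff` cancel the auxiliary knots, so that vertex data are the
ratios `sigma`, `sigma'` of the knots with repeated ends and edge data are Kronecker deltas
(`bspline_eq_tensorForm`). All coefficients are then visibly non-negative.

Reproduction is a Marsden identity (`sum_marsden_mul_bspline`): for `r + s ≤ 2` the monomial `x ^ r
* y ^ s` has as B-spline coefficient the product of the blossoms of `x ^ r` at `x_{i-1}, x_i` and of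
`y ^ s` at `y_{j-1}, y_j`. The case `r = s = 0` is the partition of unity. Hence an operator `∑
ν_{ij}(f) B_{ij}` is exact on quadratics as soon as each `ν_{ij}` sends these monomials to these
products, which `mu_monomial` and `muStar_monomial` verify.

Since the B-splines are non-negative and sum to one, the operator norm is at most the largest norm
of a functional. For `μ_{ij}` this is at most `5`, because `a_i + c_i = -σ_i σ'_{i+1}` lies in `[-1,
0]` in each direction; for `μ*_{ij}` it is at most `2 + 4 / 4 = 3`. -/

noncomputable section

namespace CrissCross

/-! ### Bernstein–Bézier form on a single cell -/

/-- `cellValue` is linear in its eight coefficients. -/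
theorem exists_cellValue_eq (u v : ℝ) : ∃ w : Fin 8 → ℝ, ∀ cA cB cC cD cAB cBC cCD cDA : ℝ,
    cellValue cA cB cC cD cAB cBC cCD cDA u v =
      w 0 * cA + w 1 * cB + w 2 * cC + w 3 * cD + w 4 * cAB + w 5 * cBC + w 6 * cCD
        + w 7 * cDA := by
  let α := max 0 (1 - u - v)
  let β := max 0 (u - v)
  let γ := max 0 (u + v - 1)
  let δ := max 0 (v - u)
  let ω := 2 * min (min u (1 - u)) (min v (1 - v))
  -- A side coefficient enters directly, through the centre (`ω ^ 2 / 4`), and through the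
  -- half-diagonals at both of its ends.
  refine ⟨![α ^ 2, β ^ 2, γ ^ 2, δ ^ 2, ω ^ 2 / 4 + 2 * α * β + ω * (α + β),
    ω ^ 2 / 4 + 2 * β * γ + ω * (β + γ), ω ^ 2 / 4 + 2 * γ * δ + ω * (γ + δ),
    ω ^ 2 / 4 + 2 * δ * α + ω * (δ + α)], fun cA cB cC cD cAB cBC cCD cDA => ?_⟩
  simp only [cellValue, Matrix.cons_val]
  ring

theorem cellValue_nonneg {cA cB cC cD cAB cBC cCD cDA u v : ℝ}
    (hA : 0 ≤ cA) (hB : 0 ≤ cB) (hC : 0 ≤ cC) (hD : 0 ≤ cD)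
    (hAB : 0 ≤ cAB) (hBC : 0 ≤ cBC) (hCD : 0 ≤ cCD) (hDA : 0 ≤ cDA)
    (hu : u ∈ Set.Icc (0 : ℝ) 1) (hv : v ∈ Set.Icc (0 : ℝ) 1) :
    0 ≤ cellValue cA cB cC cD cAB cBC cCD cDA u v := by
  have hω : 0 ≤ min (min u (1 - u)) (min v (1 - v)) :=
    le_min (le_min hu.1 (by linarith [hu.2])) (le_min hv.1 (by linarith [hv.2]))
  simp only [cellValue]
  positivity

theorem continuous_cellValue (cA cB cC cD cAB cBC cCD cDA : ℝ) :
    Continuous fun z : ℝ × ℝ => cellValue cA cB cC cD cAB cBC cCD cDA z.1 z.2 := by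
  unfold cellValue
  fun_prop

/-- The value on the left side depends on the coefficients of that side only. -/
theorem cellValue_left (cA cB cC cD cAB cBC cCD cDA : ℝ) {v : ℝ} (hv : v ∈ Set.Icc (0 : ℝ) 1) :
    cellValue cA cB cC cD cAB cBC cCD cDA 0 v
      = (1 - v) ^ 2 * cA + v ^ 2 * cD + 2 * v * (1 - v) * cDA := by
  obtain ⟨h0, h1⟩ := hv
  have e1 : min (min (0 : ℝ) (1 - 0)) (min v (1 - v)) = 0 := by
    rw [min_eq_left (by norm_num : (0 : ℝ) ≤ 1 - 0)]
    exact min_eq_left (le_min h0 (by linarith))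
  simp only [cellValue, e1]
  rw [max_eq_right (by linarith : (0 : ℝ) ≤ 1 - 0 - v), max_eq_left (by linarith : 0 - v ≤ 0),
    max_eq_left (by linarith : 0 + v - 1 ≤ 0), max_eq_right (by linarith : 0 ≤ v - 0)]
  ring

theorem cellValue_right (cA cB cC cD cAB cBC cCD cDA : ℝ) {v : ℝ} (hv : v ∈ Set.Icc (0 : ℝ) 1) :
    cellValue cA cB cC cD cAB cBC cCD cDA 1 v
      = (1 - v) ^ 2 * cB + v ^ 2 * cC + 2 * v * (1 - v) * cBC := by
  obtain ⟨h0, h1⟩ := hv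
  have e1 : min (min (1 : ℝ) (1 - 1)) (min v (1 - v)) = 0 := by
    rw [min_eq_right (by norm_num : (1 : ℝ) - 1 ≤ 1), sub_self]
    exact min_eq_left (le_min h0 (by linarith))
  simp only [cellValue, e1]
  rw [max_eq_left (by linarith : (1 : ℝ) - 1 - v ≤ 0), max_eq_right (by linarith : 0 ≤ 1 - v),
    max_eq_right (by linarith : 0 ≤ 1 + v - 1), max_eq_left (by linarith : v - 1 ≤ 0)]
  ring

/-- `cellValue` is invariant under reflection of the square in its main diagonal. -/
theorem cellValue_swap (cA cB cC cD cAB cBC cCD cDA u v : ℝ) :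
    cellValue cA cB cC cD cAB cBC cCD cDA u v = cellValue cA cD cC cB cDA cCD cBC cAB v u := by
  simp only [cellValue]
  rw [min_comm (min u (1 - u)), sub_right_comm 1 u v, add_comm u v]
  ring

theorem cellValue_bottom (cA cB cC cD cAB cBC cCD cDA : ℝ) {u : ℝ} (hu : u ∈ Set.Icc (0 : ℝ) 1) :
    cellValue cA cB cC cD cAB cBC cCD cDA u 0
      = (1 - u) ^ 2 * cA + u ^ 2 * cB + 2 * u * (1 - u) * cAB := by
  rw [cellValue_swap, cellValue_left _ _ _ _ _ _ _ _ hu]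

theorem cellValue_top (cA cB cC cD cAB cBC cCD cDA : ℝ) {u : ℝ} (hu : u ∈ Set.Icc (0 : ℝ) 1) :
    cellValue cA cB cC cD cAB cBC cCD cDA u 1
      = (1 - u) ^ 2 * cD + u ^ 2 * cC + 2 * u * (1 - u) * cCD := by
  rw [cellValue_swap, cellValue_right _ _ _ _ _ _ _ _ hu]

/-- Barycentric coordinates of a point of the unit square, by triangles. -/
theorem barycentric_cases {u v : ℝ} (hu : u ∈ Set.Icc (0 : ℝ) 1) (hv : v ∈ Set.Icc (0 : ℝ) 1) :
    (max 0 (1 - u - v) = 1 - u - v ∧ max 0 (u + v - 1) = 0 ∨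
      max 0 (1 - u - v) = 0 ∧ max 0 (u + v - 1) = u + v - 1) ∧
    (max 0 (u - v) = u - v ∧ max 0 (v - u) = 0 ∨
      max 0 (u - v) = 0 ∧ max 0 (v - u) = v - u) ∧
    2 * min (min u (1 - u)) (min v (1 - v)) =
      1 - max 0 (1 - u - v) - max 0 (u + v - 1) - max 0 (u - v) - max 0 (v - u) := by
  obtain ⟨hu0, hu1⟩ := hu
  obtain ⟨hv0, hv1⟩ := hv
  refine ⟨?_, ?_, ?_⟩
  · rcases le_total (u + v) 1 with h | h
    · exact .inl ⟨max_eq_right (by linarith), max_eq_left (by linarith)⟩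
    · exact .inr ⟨max_eq_left (by linarith), max_eq_right (by linarith)⟩
  · rcases le_total v u with h | h
    · exact .inl ⟨max_eq_right (by linarith), max_eq_left (by linarith)⟩
    · exact .inr ⟨max_eq_left (by linarith), max_eq_right (by linarith)⟩
  · simp only [max_def, min_def]
    split_ifs <;> linarith

/-- The blossom of the monomial `t ^ r`, `r ≤ 2`, at `(p, q)`. -/
def blossom (r : ℕ) (p q : ℝ) : ℝ :=
  if r = 0 then 1 else if r = 1 then (p + q) / 2 else p * q

/-- Quadratic monomials on a cell in Bernstein–Bézier form. -/
theorem cellValue_monomial {r s : ℕ} (hrs : r + s ≤ 2) (p p' q q' : ℝ) {u v : ℝ}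
    (hu : u ∈ Set.Icc (0 : ℝ) 1) (hv : v ∈ Set.Icc (0 : ℝ) 1) :
    cellValue (p ^ r * q ^ s) (p' ^ r * q ^ s) (p' ^ r * q' ^ s) (p ^ r * q' ^ s)
      (blossom r p p' * q ^ s) (p' ^ r * blossom s q q')
      (blossom r p p' * q' ^ s) (p ^ r * blossom s q q') u v
      = (p + u * (p' - p)) ^ r * (q + v * (q' - q)) ^ s := by
  obtain ⟨h1, h2, h3⟩ := barycentric_cases hu hv
  simp only [cellValue, h3]
  have : r ≤ 2 := by omega
  have : s ≤ 2 := by omega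
  -- On each triangle the five coordinates are affine in `u, v`, so the claim is a polynomial
  -- identity. The averaged inner coefficients are those of a quadratic because the centre is the
  -- midpoint of both diagonals.
  rcases h1 with ⟨e1, e2⟩ | ⟨e1, e2⟩ <;> rcases h2 with ⟨e3, e4⟩ | ⟨e3, e4⟩ <;>
    rw [e1, e2, e3, e4] <;> interval_cases r <;> interval_cases s <;>
    first
    | omega
    | (simp [blossom]; ring)

/-! ### Classical B-splines on closed cells -/

/-- The factor of `vertexCoeff` belonging to one direction. -/
def nodeWeight (x : ℤ → ℝ) (i a : ℤ) : ℝ :=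
  if a = i - 1 then barSigma' x i else if a = i then barSigma x (i + 1) else 0

/-- The polynomial piece of the classical B-spline `(i, j)` on the cell `(a, b)`. -/
def cellForm (x y : ℤ → ℝ) (i j a b : ℤ) (P : ℝ × ℝ) : ℝ :=
  cellValue
    (nodeWeight x i (a - 1) * nodeWeight y j (b - 1)) (nodeWeight x i a * nodeWeight y j (b - 1))
    (nodeWeight x i a * nodeWeight y j b) (nodeWeight x i (a - 1) * nodeWeight y j b)
    (if a = i then nodeWeight y j (b - 1) else 0) (if b = j then nodeWeight x i a else 0)
    (if a = i then nodeWeight y j b else 0) (if b = j then nodeWeight x i (a - 1) else 0)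
    ((P.1 - x (a - 1)) / barStep x a) ((P.2 - y (b - 1)) / barStep y b)

/-- Outside the three central columns all eight coefficients vanish. This lets `cellForm` describe
every B-spline on a given cell, with no case distinction on supports. -/
theorem cellForm_eq_zero_left (x y : ℤ → ℝ) {i j a b : ℤ} (P : ℝ × ℝ)
    (h : a ∉ Finset.Icc (i - 1) (i + 1)) : cellForm x y i j a b P = 0 := by
  have h1 : ¬ a - 1 = i - 1 ∧ ¬ a - 1 = i ∧ ¬ a = i - 1 ∧ ¬ a = i := by
    simp only [Finset.mem_Icc] at h; omega
  simp [cellForm, nodeWeight, h1, cellValue]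

theorem cellForm_eq_zero_right (x y : ℤ → ℝ) {i j a b : ℤ} (P : ℝ × ℝ)
    (h : b ∉ Finset.Icc (j - 1) (j + 1)) : cellForm x y i j a b P = 0 := by
  have h1 : ¬ b - 1 = j - 1 ∧ ¬ b - 1 = j ∧ ¬ b = j - 1 ∧ ¬ b = j := by
    simp only [Finset.mem_Icc] at h; omega
  simp [cellForm, nodeWeight, h1, cellValue]

theorem barStep_pos {m : ℕ} {x : ℤ → ℝ} (hx : StrictMonoOn x (Set.Icc (-2) ((m : ℤ) + 2)))
    {i : ℤ} (h0 : -1 ≤ i) (h1 : i ≤ m + 2) : 0 < barStep x i :=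
  sub_pos.2 (hx ⟨by omega, by omega⟩ ⟨by omega, by omega⟩ (by omega))

/-- The half-open cells of a direction are disjoint. -/
theorem halfOpen_iff {m : ℕ} {x : ℤ → ℝ} (hx : StrictMonoOn x (Set.Icc (-2) ((m : ℤ) + 2)))
    {a c : ℤ} {t : ℝ} (ha : a ∈ Set.Icc (-1 : ℤ) (m + 2)) (hc : c ∈ Set.Icc (-1 : ℤ) (m + 2))
    (h0 : x (a - 1) ≤ t) (h1 : t < x a) : (x (c - 1) ≤ t ∧ t < x c) ↔ c = a := by
  obtain ⟨ha0, ha1⟩ := ha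
  obtain ⟨hc0, hc1⟩ := hc
  constructor
  · rintro ⟨h2, h3⟩
    rcases lt_trichotomy c a with h | h | h
    · have := hx.monotoneOn (a := c) (b := a - 1) ⟨by omega, by omega⟩ ⟨by omega, by omega⟩
        (by omega)
      linarith
    · exact h
    · have := hx.monotoneOn (a := a) (b := c - 1) ⟨by omega, by omega⟩ ⟨by omega, by omega⟩
        (by omega)
      linarith
  · rintro rfl
    exact ⟨h0, h1⟩

theorem classicalB_eq_cellForm_of_halfOpen {m n : ℕ} {x y : ℤ → ℝ}
    (hx : StrictMonoOn x (Set.Icc (-2) ((m : ℤ) + 2)))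
    (hy : StrictMonoOn y (Set.Icc (-2) ((n : ℤ) + 2))) {i j a b : ℤ}
    (hi : i ∈ Set.Icc (0 : ℤ) (m + 1)) (hj : j ∈ Set.Icc (0 : ℤ) (n + 1))
    (ha : a ∈ Set.Icc (-1 : ℤ) (m + 2)) (hb : b ∈ Set.Icc (-1 : ℤ) (n + 2)) {P : ℝ × ℝ}
    (h0 : x (a - 1) ≤ P.1) (h1 : P.1 < x a) (h2 : y (b - 1) ≤ P.2) (h3 : P.2 < y b) :
    classicalB x y i j P = cellForm x y i j a b P := by
  have key : classicalB x y i j P =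
      ∑ c ∈ Finset.Icc (i - 1) (i + 1), ∑ d ∈ Finset.Icc (j - 1) (j + 1),
        if c = a then if d = b then cellForm x y i j a b P else 0 else 0 := by
    refine Finset.sum_congr rfl fun c hc => Finset.sum_congr rfl fun d hd => ?_
    rw [Finset.mem_Icc] at hc hd
    rw [Set.mem_Icc] at hi hj
    have e1 := halfOpen_iff hx ha (c := c) ⟨by omega, by omega⟩ h0 h1
    have e2 := halfOpen_iff hy hb (c := d) ⟨by omega, by omega⟩ h2 h3
    have e : (x (c - 1) ≤ P.1 ∧ P.1 < x c ∧ y (d - 1) ≤ P.2 ∧ P.2 < y d) ↔ c = a ∧ d = b := by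
      rw [← and_assoc, e1, e2]
    simp only [e]
    by_cases hca : c = a
    · by_cases hdb : d = b
      · subst hca hdb
        simp only [and_self, if_true]
        rfl
      · simp [hdb]
    · simp [hca]
  rw [key]
  by_cases hca : a ∈ Finset.Icc (i - 1) (i + 1)
  · by_cases hdb : b ∈ Finset.Icc (j - 1) (j + 1)
    · rw [Finset.sum_eq_single_of_mem a hca fun c _ hc => by simp [hc],
        Finset.sum_eq_single_of_mem b hdb fun d _ hd => by simp [hd]]
      simp
    · rw [cellForm_eq_zero_right x y P hdb]
      simp
  · rw [cellForm_eq_zero_left x y P hca]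
    simp

theorem local_mem_unit {x : ℤ → ℝ} {a : ℤ} {t : ℝ} (hs : 0 < barStep x a) (h0 : x (a - 1) ≤ t)
    (h1 : t ≤ x a) : (t - x (a - 1)) / barStep x a ∈ Set.Icc (0 : ℝ) 1 :=
  ⟨div_nonneg (by linarith) hs.le, (div_le_one hs).2 (by unfold barStep; linarith)⟩

/-- Two adjacent cells share the coefficients of their common edge, and these alone determine the
values on it. -/
theorem cellForm_succ_left {x y : ℤ → ℝ} (i j : ℤ) {a b : ℤ} {P : ℝ × ℝ} (ha : 0 < barStep x a)
    (hP : P.1 = x a) (hv : (P.2 - y (b - 1)) / barStep y b ∈ Set.Icc (0 : ℝ) 1) :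
    cellForm x y i j (a + 1) b P = cellForm x y i j a b P := by
  have e1 : (P.1 - x (a - 1)) / barStep x a = 1 := by
    rw [hP]; exact div_self ha.ne'
  have e2 : (P.1 - x (a + 1 - 1)) / barStep x (a + 1) = 0 := by
    rw [hP, add_sub_cancel_right, sub_self, zero_div]
  unfold cellForm
  rw [e1, e2, cellValue_left _ _ _ _ _ _ _ _ hv, cellValue_right _ _ _ _ _ _ _ _ hv,
    add_sub_cancel_right]

theorem cellForm_succ_right {x y : ℤ → ℝ} (i j : ℤ) {a b : ℤ} {P : ℝ × ℝ} (hb : 0 < barStep y b)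
    (hP : P.2 = y b) (hu : (P.1 - x (a - 1)) / barStep x a ∈ Set.Icc (0 : ℝ) 1) :
    cellForm x y i j a (b + 1) P = cellForm x y i j a b P := by
  have e1 : (P.2 - y (b - 1)) / barStep y b = 1 := by
    rw [hP]; exact div_self hb.ne'
  have e2 : (P.2 - y (b + 1 - 1)) / barStep y (b + 1) = 0 := by
    rw [hP, add_sub_cancel_right, sub_self, zero_div]
  unfold cellForm
  rw [e1, e2, cellValue_bottom _ _ _ _ _ _ _ _ hu, cellValue_top _ _ _ _ _ _ _ _ hu,
    add_sub_cancel_right]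

/-- The closed cell `[x (a - 1), x a] × [y (b - 1), y b]`. -/
def cell (x y : ℤ → ℝ) (a b : ℤ) : Set (ℝ × ℝ) := Set.Icc (x (a - 1), y (b - 1)) (x a, y b)

/-- The half-open cells in `classicalB` assign a right or top edge to the next cell; agreement along
the shared edge carries the value back. This is why the index range stops one short of the half-open
version. -/
theorem classicalB_eq_cellForm {m n : ℕ} {x y : ℤ → ℝ}
    (hx : StrictMonoOn x (Set.Icc (-2) ((m : ℤ) + 2)))
    (hy : StrictMonoOn y (Set.Icc (-2) ((n : ℤ) + 2))) {i j a b : ℤ}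
    (hi : i ∈ Set.Icc (0 : ℤ) (m + 1)) (hj : j ∈ Set.Icc (0 : ℤ) (n + 1))
    (ha : a ∈ Set.Icc (-1 : ℤ) (m + 1)) (hb : b ∈ Set.Icc (-1 : ℤ) (n + 1)) {P : ℝ × ℝ}
    (hP : P ∈ cell x y a b) :
    classicalB x y i j P = cellForm x y i j a b P := by
  obtain ⟨⟨h0, h2⟩, h1, h3⟩ := hP
  dsimp only at h0 h1 h2 h3
  obtain ⟨ha0, ha1⟩ := ha
  obtain ⟨hb0, hb1⟩ := hb
  have sa : 0 < barStep x a := barStep_pos hx ha0 (by omega)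
  have sb : 0 < barStep y b := barStep_pos hy hb0 (by omega)
  have sa' : 0 < barStep x (a + 1) := barStep_pos hx (by omega) (by omega)
  have sb' : 0 < barStep y (b + 1) := barStep_pos hy (by omega) (by omega)
  have la : x a < x (a + 1) := by
    unfold barStep at sa'; rw [add_sub_cancel_right] at sa'; linarith
  have lb : y b < y (b + 1) := by
    unfold barStep at sb'; rw [add_sub_cancel_right] at sb'; linarith
  have hu := local_mem_unit sa h0 h1
  have hv := local_mem_unit sb h2 h3
  rcases h1.lt_or_eq with h1 | h1 <;> rcases h3.lt_or_eq with h3 | h3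
  · exact classicalB_eq_cellForm_of_halfOpen hx hy hi hj ⟨ha0, by omega⟩ ⟨hb0, by omega⟩
      h0 h1 h2 h3
  · rw [← cellForm_succ_right i j sb h3 hu]
    exact classicalB_eq_cellForm_of_halfOpen hx hy hi hj ⟨ha0, by omega⟩ ⟨by omega, by omega⟩
      h0 h1 (by rw [add_sub_cancel_right, h3]) (h3 ▸ lb)
  · rw [← cellForm_succ_left i j sa h1 hv]
    exact classicalB_eq_cellForm_of_halfOpen hx hy hi hj ⟨by omega, by omega⟩ ⟨hb0, by omega⟩
      (by rw [add_sub_cancel_right, h1]) (h1 ▸ la) h2 h3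
  -- At the upper right corner the passage goes right first, then up inside column `a + 1`.
  · have hu' : (P.1 - x (a + 1 - 1)) / barStep x (a + 1) ∈ Set.Icc (0 : ℝ) 1 :=
      local_mem_unit sa' (by rw [add_sub_cancel_right, h1]) (h1 ▸ la.le)
    rw [← cellForm_succ_left i j sa h1 hv, ← cellForm_succ_right i j sb h3 hu']
    exact classicalB_eq_cellForm_of_halfOpen hx hy hi hj ⟨by omega, by omega⟩
      ⟨by omega, by omega⟩ (by rw [add_sub_cancel_right, h1]) (h1 ▸ la)
      (by rw [add_sub_cancel_right, h3]) (h3 ▸ lb)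

/-! ### Knots, step lengths and ratios -/

theorem knot_of_mem {m : ℕ} {x : ℤ → ℝ} {i : ℤ} (h0 : 0 ≤ i) (h1 : i ≤ m) : knot m x i = x i := by
  unfold knot
  congr 1
  omega

theorem knot_mono {m : ℕ} {x : ℤ → ℝ}
    (hx : StrictMonoOn x (Set.Icc (-2) ((m : ℤ) + 2))) : Monotone (knot m x) := fun i j hij =>
  hx.monotoneOn ⟨by omega, by omega⟩ ⟨by omega, by omega⟩ (by omega)

theorem knot_mem {m : ℕ} {x : ℤ → ℝ}
    (hx : StrictMonoOn x (Set.Icc (-2) ((m : ℤ) + 2))) (i : ℤ) : knot m x i ∈ Set.Icc (x 0) (x m) :=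
  ⟨hx.monotoneOn ⟨by omega, by omega⟩ ⟨by omega, by omega⟩ (by omega),
    hx.monotoneOn ⟨by omega, by omega⟩ ⟨by omega, by omega⟩ (by omega)⟩

theorem mid_mem {m : ℕ} {x : ℤ → ℝ}
    (hx : StrictMonoOn x (Set.Icc (-2) ((m : ℤ) + 2))) (i : ℤ) : mid m x i ∈ Set.Icc (x 0) (x m) := by
  have h := knot_mem hx i
  have h' := knot_mem hx (i - 1)
  rw [Set.mem_Icc] at *
  unfold mid
  constructor <;> linarith

theorem step_nonneg {m : ℕ} {x : ℤ → ℝ}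
    (hx : StrictMonoOn x (Set.Icc (-2) ((m : ℤ) + 2))) (i : ℤ) : 0 ≤ step m x i :=
  sub_nonneg.2 (knot_mono hx (by omega))

theorem step_pos {m : ℕ} {x : ℤ → ℝ}
    (hx : StrictMonoOn x (Set.Icc (-2) ((m : ℤ) + 2))) {i : ℤ} (h0 : 1 ≤ i) (h1 : i ≤ m) : 0 < step m x i := by
  unfold step
  rw [knot_of_mem (by omega) h1, knot_of_mem (by omega) (by omega), sub_pos]
  exact hx ⟨by omega, by omega⟩ ⟨by omega, by omega⟩ (by omega)

/-- These are the denominators of `sigma` and `sigma'` at `a + 1`. At either end of the range one of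
the two steps is zero, and `1 ≤ m` keeps the other positive. -/
theorem step_add_step_pos {m : ℕ} {x : ℤ → ℝ}
    (hx : StrictMonoOn x (Set.Icc (-2) ((m : ℤ) + 2))) (hm : 1 ≤ m) {a : ℤ} (h0 : 0 ≤ a) (h1 : a ≤ m) :
    0 < step m x a + step m x (a + 1) := by
  rcases h0.eq_or_lt with rfl | h
  · exact add_pos_of_nonneg_of_pos (step_nonneg hx _) (step_pos hx (by omega) (by omega))
  · exact add_pos_of_pos_of_nonneg (step_pos hx h h1) (step_nonneg hx _)

/-- No range is imposed on `i`: where both steps vanish the quotient is `0` by convention, so this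
bound and the next three survive. -/
theorem sigma_nonneg {m : ℕ} {x : ℤ → ℝ}
    (hx : StrictMonoOn x (Set.Icc (-2) ((m : ℤ) + 2))) (i : ℤ) : 0 ≤ sigma m x i :=
  div_nonneg (step_nonneg hx _) (add_nonneg (step_nonneg hx _) (step_nonneg hx _))

theorem sigma'_nonneg {m : ℕ} {x : ℤ → ℝ}
    (hx : StrictMonoOn x (Set.Icc (-2) ((m : ℤ) + 2))) (i : ℤ) : 0 ≤ sigma' m x i :=
  div_nonneg (step_nonneg hx _) (add_nonneg (step_nonneg hx _) (step_nonneg hx _))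

theorem sigma_le_one {m : ℕ} {x : ℤ → ℝ}
    (hx : StrictMonoOn x (Set.Icc (-2) ((m : ℤ) + 2))) (i : ℤ) : sigma m x i ≤ 1 :=
  div_le_one_of_le₀ (le_add_of_nonneg_left (step_nonneg hx _))
    (add_nonneg (step_nonneg hx _) (step_nonneg hx _))

theorem sigma'_le_one {m : ℕ} {x : ℤ → ℝ}
    (hx : StrictMonoOn x (Set.Icc (-2) ((m : ℤ) + 2))) (i : ℤ) : sigma' m x i ≤ 1 :=
  div_le_one_of_le₀ (le_add_of_nonneg_right (step_nonneg hx _))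
    (add_nonneg (step_nonneg hx _) (step_nonneg hx _))

theorem sigma_pos {m : ℕ} {x : ℤ → ℝ}
    (hx : StrictMonoOn x (Set.Icc (-2) ((m : ℤ) + 2))) {i : ℤ} (h0 : 1 ≤ i) (h1 : i ≤ m) : 0 < sigma m x i :=
  div_pos (step_pos hx h0 h1) (add_pos_of_nonneg_of_pos (step_nonneg hx _) (step_pos hx h0 h1))

/-! ### B-splines of the rectangle on closed cells -/

/-- A quadratic patch on the unit square whose coefficients are products of one-dimensional data:
the values `p, p'` and `q, q'` at the ends of an interval and `e, e'` at its midpoint. -/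
def tensorForm (p p' e q q' e' u v : ℝ) : ℝ :=
  cellValue (p * q) (p' * q) (p' * q') (p * q') (e * q) (p' * e') (e * q') (p * e') u v

/-- The patch is not a tensor product of functions, but it is linear in its coefficients, and each
of these is a product; so the double sum factors coefficient by coefficient. -/
theorem sum_sum_tensorForm {ι κ : Type*} (S : Finset ι) (T : Finset κ) (f p p' e : ι → ℝ)
    (g q q' e' : κ → ℝ) (u v : ℝ) :
    ∑ i ∈ S, ∑ j ∈ T, f i * g j * tensorForm (p i) (p' i) (e i) (q j) (q' j) (e' j) u v =
      tensorForm (∑ i ∈ S, f i * p i) (∑ i ∈ S, f i * p' i) (∑ i ∈ S, f i * e i)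
        (∑ j ∈ T, g j * q j) (∑ j ∈ T, g j * q' j) (∑ j ∈ T, g j * e' j) u v := by
  obtain ⟨w, hw⟩ := exists_cellValue_eq u v
  simp only [tensorForm, hw, Finset.sum_mul_sum]
  simp only [Finset.mul_sum, ← Finset.sum_add_distrib]
  refine Finset.sum_congr rfl fun i _ => Finset.sum_congr rfl fun j _ => ?_
  ring

/-- The coefficient of the B-spline `i` of a bounded interval at the knot `x a`. -/
def nodeCoeff (m : ℕ) (x : ℤ → ℝ) (i a : ℤ) : ℝ :=
  (if i = a + 1 then sigma' m x (a + 1) else 0) + if i = a then sigma m x (a + 1) else 0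

theorem layerCoeff_of_mem {m : ℕ} (x : ℤ → ℝ) (i : ℤ) {a : ℤ} (ha : a ∈ Set.Icc (1 : ℤ) m) :
    layerCoeff m x i a = if i = a then 1 else 0 := by
  obtain ⟨h0, h1⟩ := ha
  unfold layerCoeff
  split_ifs <;> first | omega | simp

theorem barStep_eq_step {m : ℕ} {x : ℤ → ℝ} {i : ℤ} (h0 : 1 ≤ i) (h1 : i ≤ m) :
    barStep x i = step m x i := by
  unfold barStep step
  rw [knot_of_mem (by omega) h1, knot_of_mem (by omega) (by omega)]

theorem step_zero (m : ℕ) (x : ℤ → ℝ) : step m x 0 = 0 := by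
  simp [step, knot]

theorem step_succ (m : ℕ) (x : ℤ → ℝ) : step m x (m + 1) = 0 := by
  simp [step, knot]

/-- Only `k = a` and `k = a + 1` contribute. At an end knot the corrections are tuned so that the
end spline gets the value `1` and its neighbour `-σ̄' + σ̄' = 0` (with `σ̄` replacing `σ̄'` on the
right); at inner knots nothing is corrected and the two kinds of ratio agree. -/
theorem sum_layerCoeff_mul_nodeWeight {m : ℕ} (hm : 1 ≤ m) {x : ℤ → ℝ}
    (hx : StrictMonoOn x (Set.Icc (-2) ((m : ℤ) + 2))) {i a : ℤ}
    (hi : i ∈ Set.Icc (0 : ℤ) (m + 1)) (ha : a ∈ Set.Icc (0 : ℤ) m) :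
    ∑ k ∈ Finset.Icc (0 : ℤ) (m + 1), layerCoeff m x i k * nodeWeight x k a
      = nodeCoeff m x i a := by
  obtain ⟨ha0, ha1⟩ := ha
  obtain ⟨hi0, hi1⟩ := hi
  have hs : ∑ k ∈ Finset.Icc (0 : ℤ) (m + 1), layerCoeff m x i k * nodeWeight x k a
      = layerCoeff m x i a * barSigma x (a + 1)
        + layerCoeff m x i (a + 1) * barSigma' x (a + 1) := by
    rw [← Finset.sum_subset (s₁ := {a, a + 1})]
    · rw [Finset.sum_pair (by omega)]
      have h : ¬ a = a - 1 := by omega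
      simp [nodeWeight, h]
    · intro k
      simp only [Finset.mem_insert, Finset.mem_singleton, Finset.mem_Icc]
      omega
    · intro k _ hk
      simp only [Finset.mem_insert, Finset.mem_singleton, not_or] at hk
      have h1 : ¬ a = k - 1 := by omega
      have h2 : ¬ a = k := by omega
      simp [nodeWeight, h1, h2]
  have p0 : 0 < barStep x a := barStep_pos hx (by omega) (by omega)
  have p1 : 0 < barStep x (a + 1) := barStep_pos hx (by omega) (by omega)
  have q : barSigma x (a + 1) ≠ 0 := by
    unfold barSigma; rw [add_sub_cancel_right]; positivity
  have q' : barSigma' x (a + 1) ≠ 0 := by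
    unfold barSigma'; rw [add_sub_cancel_right]; positivity
  rw [hs, nodeCoeff]
  rcases ha0.eq_or_lt with rfl | ha0
  · have e1 : sigma m x (0 + 1) = 1 := by
      have : 0 < step m x 1 := step_pos hx le_rfl (by omega)
      simp [sigma, step_zero, this.ne']
    have e2 : sigma' m x (0 + 1) = 0 := by simp [sigma', step_zero]
    rw [e1, e2, layerCoeff_of_mem x i (a := 0 + 1) ⟨by omega, by omega⟩]
    rw [zero_add] at *
    unfold layerCoeff
    split_ifs <;> first | omega | (field_simp; try ring)
  rcases ha1.eq_or_lt with rfl | ha1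
  · have e1 : sigma m x (m + 1) = 0 := by simp [sigma, step_succ]
    have e2 : sigma' m x (m + 1) = 1 := by
      have : 0 < step m x m := step_pos hx (by omega) le_rfl
      simp [sigma', step_succ, this.ne']
    rw [e1, e2, layerCoeff_of_mem x i (a := m) ⟨by omega, by omega⟩]
    unfold layerCoeff
    split_ifs <;> first | omega | (field_simp; try ring)
  · have e1 : barSigma x (a + 1) = sigma m x (a + 1) := by
      simp only [barSigma, sigma, add_sub_cancel_right]
      rw [barStep_eq_step (m := m) ha0 (by omega), barStep_eq_step (m := m) (by omega) (by omega)]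
    have e2 : barSigma' x (a + 1) = sigma' m x (a + 1) := by
      simp only [barSigma', sigma', add_sub_cancel_right]
      rw [barStep_eq_step (m := m) ha0 (by omega), barStep_eq_step (m := m) (by omega) (by omega)]
    rw [layerCoeff_of_mem x i ⟨by omega, by omega⟩, layerCoeff_of_mem x i ⟨by omega, by omega⟩,
      e1, e2]
    simp only [ite_mul, one_mul, zero_mul]
    rw [add_comm]

/-- The B-spline `(i, j)` of the rectangle on the closed cell `(a, b)`. -/
theorem bspline_eq_tensorForm {m n : ℕ} (hm : 1 ≤ m) (hn : 1 ≤ n) {x y : ℤ → ℝ}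
    (hx : StrictMonoOn x (Set.Icc (-2) ((m : ℤ) + 2)))
    (hy : StrictMonoOn y (Set.Icc (-2) ((n : ℤ) + 2))) {i j a b : ℤ}
    (hi : i ∈ Set.Icc (0 : ℤ) (m + 1)) (hj : j ∈ Set.Icc (0 : ℤ) (n + 1))
    (ha : a ∈ Set.Icc (1 : ℤ) m) (hb : b ∈ Set.Icc (1 : ℤ) n) {P : ℝ × ℝ}
    (hP : P ∈ cell x y a b) :
    bspline m n x y i j P =
      tensorForm (nodeCoeff m x i (a - 1)) (nodeCoeff m x i a) (if i = a then 1 else 0)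
        (nodeCoeff n y j (b - 1)) (nodeCoeff n y j b) (if j = b then 1 else 0)
        ((P.1 - x (a - 1)) / barStep x a) ((P.2 - y (b - 1)) / barStep y b) := by
  have hform : ∀ k l : ℤ, cellForm x y k l a b P =
      tensorForm (nodeWeight x k (a - 1)) (nodeWeight x k a) (if a = k then 1 else 0)
        (nodeWeight y l (b - 1)) (nodeWeight y l b) (if b = l then 1 else 0)
        ((P.1 - x (a - 1)) / barStep x a) ((P.2 - y (b - 1)) / barStep y b) := by
    intro k l
    simp only [cellForm, tensorForm, ite_mul, mul_ite, one_mul, mul_one, zero_mul, mul_zero]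
  have hedge : ∀ {m : ℕ} (x : ℤ → ℝ) (i : ℤ) {a : ℤ}, a ∈ Set.Icc (1 : ℤ) m →
      ∑ k ∈ Finset.Icc (0 : ℤ) (m + 1), layerCoeff m x i k * (if a = k then 1 else 0)
        = if i = a then 1 else 0 := by
    intro m x i a ha
    rw [← layerCoeff_of_mem x i ha]
    obtain ⟨h0, h1⟩ := ha
    simp only [mul_ite, mul_one, mul_zero]
    rw [Finset.sum_ite_eq, if_pos (Finset.mem_Icc.2 ⟨by omega, by omega⟩)]
  have hsum : bspline m n x y i j P =
      ∑ k ∈ Finset.Icc (0 : ℤ) (m + 1), ∑ l ∈ Finset.Icc (0 : ℤ) (n + 1),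
        layerCoeff m x i k * layerCoeff n y j l * cellForm x y k l a b P := by
    refine Finset.sum_congr rfl fun k hk => Finset.sum_congr rfl fun l hl => ?_
    rw [classicalB_eq_cellForm hx hy (Finset.mem_Icc.1 hk) (Finset.mem_Icc.1 hl)
      ⟨by linarith [ha.1], by linarith [ha.2]⟩ ⟨by linarith [hb.1], by linarith [hb.2]⟩ hP]
  obtain ⟨ha0, ha1⟩ := ha
  obtain ⟨hb0, hb1⟩ := hb
  simp only [hsum, hform]
  rw [sum_sum_tensorForm, hedge x i ⟨ha0, ha1⟩, hedge y j ⟨hb0, hb1⟩,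
    sum_layerCoeff_mul_nodeWeight hm hx hi ⟨by omega, by omega⟩,
    sum_layerCoeff_mul_nodeWeight hm hx hi ⟨by omega, by omega⟩,
    sum_layerCoeff_mul_nodeWeight hn hy hj ⟨by omega, by omega⟩,
    sum_layerCoeff_mul_nodeWeight hn hy hj ⟨by omega, by omega⟩]

/-- Every point of an interval lies between two neighbouring knots. -/
theorem exists_mem_step {m : ℕ} (hm : 1 ≤ m) (x : ℤ → ℝ) {t : ℝ} (h0 : x 0 ≤ t) (h1 : t ≤ x m) :
    ∃ a ∈ Set.Icc (1 : ℤ) m, x (a - 1) ≤ t ∧ t ≤ x a := by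
  induction m, hm using Nat.le_induction with
  | base => exact ⟨1, by simp, by simpa using h0, by simpa using h1⟩
  | succ m hm ih =>
    rcases le_total t (x m) with h | h
    · obtain ⟨a, ⟨ha0, ha1⟩, ha⟩ := ih h
      exact ⟨a, ⟨ha0, by push_cast; omega⟩, ha⟩
    · exact ⟨m + 1, ⟨by omega, by push_cast; omega⟩, by rwa [add_sub_cancel_right],
        by exact_mod_cast h1⟩

theorem exists_mem_cell {m n : ℕ} (hm : 1 ≤ m) (hn : 1 ≤ n) {x y : ℤ → ℝ} {P : ℝ × ℝ}
    (hP : P ∈ Omega m n x y) :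
    ∃ a ∈ Set.Icc (1 : ℤ) m, ∃ b ∈ Set.Icc (1 : ℤ) n, P ∈ cell x y a b := by
  obtain ⟨⟨h0, h2⟩, h1, h3⟩ := hP
  obtain ⟨a, ha, h4, h5⟩ := exists_mem_step hm x h0 h1
  obtain ⟨b, hb, h6, h7⟩ := exists_mem_step hn y h2 h3
  exact ⟨a, ha, b, hb, ⟨h4, h6⟩, h5, h7⟩

theorem nodeCoeff_nonneg {m : ℕ} {x : ℤ → ℝ}
    (hx : StrictMonoOn x (Set.Icc (-2) ((m : ℤ) + 2))) (i a : ℤ) : 0 ≤ nodeCoeff m x i a := by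
  have := sigma_nonneg hx (a + 1)
  have := sigma'_nonneg hx (a + 1)
  unfold nodeCoeff
  positivity

theorem local_mem_unit_of_mem_cell {m n : ℕ} {x y : ℤ → ℝ}
    (hx : StrictMonoOn x (Set.Icc (-2) ((m : ℤ) + 2)))
    (hy : StrictMonoOn y (Set.Icc (-2) ((n : ℤ) + 2))) {a b : ℤ}
    (ha : a ∈ Set.Icc (1 : ℤ) m) (hb : b ∈ Set.Icc (1 : ℤ) n) {P : ℝ × ℝ}
    (hP : P ∈ cell x y a b) :
    (P.1 - x (a - 1)) / barStep x a ∈ Set.Icc (0 : ℝ) 1 ∧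
      (P.2 - y (b - 1)) / barStep y b ∈ Set.Icc (0 : ℝ) 1 :=
  ⟨local_mem_unit (barStep_pos hx (by linarith [ha.1]) (by linarith [ha.2])) hP.1.1 hP.2.1,
    local_mem_unit (barStep_pos hy (by linarith [hb.1]) (by linarith [hb.2])) hP.1.2 hP.2.2⟩

/-- Since `layerCoeff` has negative entries, the sign cannot be inherited from the classical
B-splines; it is read off the combined coefficients. -/
theorem bspline_nonneg {m n : ℕ} (hm : 1 ≤ m) (hn : 1 ≤ n) {x y : ℤ → ℝ}
    (hx : StrictMonoOn x (Set.Icc (-2) ((m : ℤ) + 2)))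
    (hy : StrictMonoOn y (Set.Icc (-2) ((n : ℤ) + 2))) {i j : ℤ}
    (hi : i ∈ Set.Icc (0 : ℤ) (m + 1)) (hj : j ∈ Set.Icc (0 : ℤ) (n + 1)) {P : ℝ × ℝ}
    (hP : P ∈ Omega m n x y) : 0 ≤ bspline m n x y i j P := by
  obtain ⟨a, ha, b, hb, hab⟩ := exists_mem_cell hm hn hP
  obtain ⟨hu, hv⟩ := local_mem_unit_of_mem_cell hx hy ha hb hab
  rw [bspline_eq_tensorForm hm hn hx hy hi hj ha hb hab]
  have h1 := nodeCoeff_nonneg hx i (a - 1)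
  have h2 := nodeCoeff_nonneg hx i a
  have h3 := nodeCoeff_nonneg hy j (b - 1)
  have h4 := nodeCoeff_nonneg hy j b
  exact cellValue_nonneg (by positivity) (by positivity) (by positivity) (by positivity)
    (by positivity) (by positivity) (by positivity) (by positivity) hu hv

/-- The finitely many closed cells cover the rectangle, and each piece is given there by a
continuous formula. -/
theorem continuousOn_bspline {m n : ℕ} (hm : 1 ≤ m) (hn : 1 ≤ n) {x y : ℤ → ℝ}
    (hx : StrictMonoOn x (Set.Icc (-2) ((m : ℤ) + 2)))
    (hy : StrictMonoOn y (Set.Icc (-2) ((n : ℤ) + 2))) {i j : ℤ}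
    (hi : i ∈ Set.Icc (0 : ℤ) (m + 1)) (hj : j ∈ Set.Icc (0 : ℤ) (n + 1)) :
    ContinuousOn (bspline m n x y i j) (Omega m n x y) := by
  have hcover : Omega m n x y ⊆
      ⋃ c : Set.Icc (1 : ℤ) m × Set.Icc (1 : ℤ) n, cell x y c.1 c.2 := by
    intro P hP
    obtain ⟨a, ha, b, hb, hab⟩ := exists_mem_cell hm hn hP
    exact Set.mem_iUnion.2 ⟨(⟨a, ha⟩, ⟨b, hb⟩), hab⟩
  refine ContinuousOn.mono ?_ hcover
  refine (locallyFinite_of_finite _).continuousOn_iUnion (fun _ => isClosed_Icc) fun c => ?_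
  refine ContinuousOn.congr ?_ fun P hP => bspline_eq_tensorForm hm hn hx hy hi hj c.1.2 c.2.2 hP
  refine Continuous.continuousOn ?_
  exact (continuous_cellValue _ _ _ _ _ _ _ _).comp
    (f := fun P : ℝ × ℝ => ((P.1 - x (c.1 - 1)) / barStep x c.1,
      (P.2 - y (c.2 - 1)) / barStep y c.2)) (by fun_prop)

/-! ### Reproduction of quadratic polynomials -/

/-- The coefficients that represent the monomial `t ^ r`, `r ≤ 2`. -/
def marsden (m : ℕ) (x : ℤ → ℝ) (r : ℕ) (i : ℤ) : ℝ := blossom r (knot m x (i - 1)) (knot m x i)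

/-- The knot `x_a` is the convex combination of `x_{a+1}` and `x_{a-1}` with weights `σ'_{a+1}` and
`σ_{a+1}`, and a blossom is affine in each argument, so the sum is the blossom at `(x_a, x_a)`. -/
theorem sum_marsden_mul_nodeCoeff {m : ℕ} (hm : 1 ≤ m) {x : ℤ → ℝ}
    (hx : StrictMonoOn x (Set.Icc (-2) ((m : ℤ) + 2))) {r : ℕ} (hr : r ≤ 2) {a : ℤ}
    (ha : a ∈ Set.Icc (0 : ℤ) m) :
    ∑ i ∈ Finset.Icc (0 : ℤ) (m + 1), marsden m x r i * nodeCoeff m x i a = x a ^ r := by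
  obtain ⟨ha0, ha1⟩ := ha
  simp only [nodeCoeff, mul_add, mul_ite, mul_zero, Finset.sum_add_distrib]
  rw [Finset.sum_ite_eq', Finset.sum_ite_eq', if_pos (Finset.mem_Icc.2 ⟨by omega, by omega⟩),
    if_pos (Finset.mem_Icc.2 ⟨by omega, by omega⟩), ← knot_of_mem (x := x) ha0 ha1]
  have h := step_add_step_pos hx hm ha0 ha1
  simp only [marsden, sigma, sigma', add_sub_cancel_right]
  simp only [step, add_sub_cancel_right] at h ⊢
  have h' := h.ne'
  interval_cases r <;> simp only [blossom] <;> field_simp <;> simp <;> ring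

theorem sum_marsden_mul_ite {m : ℕ} {x : ℤ → ℝ} (r : ℕ) {a : ℤ} (ha : a ∈ Set.Icc (1 : ℤ) m) :
    ∑ i ∈ Finset.Icc (0 : ℤ) (m + 1), marsden m x r i * (if i = a then 1 else 0)
      = blossom r (x (a - 1)) (x a) := by
  obtain ⟨ha0, ha1⟩ := ha
  simp only [mul_ite, mul_one, mul_zero]
  rw [Finset.sum_ite_eq', if_pos (Finset.mem_Icc.2 ⟨by omega, by omega⟩), marsden,
    knot_of_mem (by omega) (by omega), knot_of_mem (by omega) (by omega)]

theorem sum_marsden_mul_bspline {m n : ℕ} (hm : 1 ≤ m) (hn : 1 ≤ n) {x y : ℤ → ℝ}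
    (hx : StrictMonoOn x (Set.Icc (-2) ((m : ℤ) + 2)))
    (hy : StrictMonoOn y (Set.Icc (-2) ((n : ℤ) + 2))) {r s : ℕ} (hrs : r + s ≤ 2) {P : ℝ × ℝ}
    (hP : P ∈ Omega m n x y) :
    ∑ i ∈ Finset.Icc (0 : ℤ) (m + 1), ∑ j ∈ Finset.Icc (0 : ℤ) (n + 1),
      marsden m x r i * marsden n y s j * bspline m n x y i j P = P.1 ^ r * P.2 ^ s := by
  obtain ⟨a, ha, b, hb, hab⟩ := exists_mem_cell hm hn hP
  obtain ⟨hu, hv⟩ := local_mem_unit_of_mem_cell hx hy ha hb hab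
  rw [Finset.sum_congr rfl fun i hi => Finset.sum_congr rfl fun j hj => by
    rw [bspline_eq_tensorForm hm hn hx hy (Finset.mem_Icc.1 hi) (Finset.mem_Icc.1 hj) ha hb hab]]
  rw [sum_sum_tensorForm, sum_marsden_mul_ite r ha, sum_marsden_mul_ite s hb]
  obtain ⟨ha0, ha1⟩ := ha
  obtain ⟨hb0, hb1⟩ := hb
  rw [sum_marsden_mul_nodeCoeff hm hx (by omega) ⟨by omega, by omega⟩,
    sum_marsden_mul_nodeCoeff hm hx (by omega) ⟨by omega, by omega⟩,
    sum_marsden_mul_nodeCoeff hn hy (by omega) ⟨by omega, by omega⟩,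
    sum_marsden_mul_nodeCoeff hn hy (by omega) ⟨by omega, by omega⟩, tensorForm,
    cellValue_monomial hrs _ _ _ _ hu hv]
  have sa : barStep x a ≠ 0 := (barStep_pos hx (by omega) (by omega)).ne'
  have sb : barStep y b ≠ 0 := (barStep_pos hy (by omega) (by omega)).ne'
  rw [← barStep, ← barStep, div_mul_cancel₀ _ sa, div_mul_cancel₀ _ sb, add_sub_cancel,
    add_sub_cancel]

/-! ### The coefficient functionals -/

/-- `μ_{ij}` as a linear functional. -/
def muLin (m n : ℕ) (x y : ℤ → ℝ) (i j : ℤ) : (ℝ × ℝ → ℝ) →ₗ[ℝ] ℝ where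
  toFun := mu m n x y i j
  map_add' f g := by simp only [mu, Pi.add_apply]; ring
  map_smul' c f := by simp only [mu, Pi.smul_apply, smul_eq_mul, RingHom.id_apply]; ring

/-- `μ*_{ij}` as a linear functional. -/
def muStarLin (m n : ℕ) (x y : ℤ → ℝ) (i j : ℤ) : (ℝ × ℝ → ℝ) →ₗ[ℝ] ℝ where
  toFun := muStar m n x y i j
  map_add' f g := by simp only [muStar, Pi.add_apply]; ring
  map_smul' c f := by simp only [muStar, Pi.smul_apply, smul_eq_mul, RingHom.id_apply]; ring

theorem siteM_mem {m n : ℕ} {x y : ℤ → ℝ} (hx : StrictMonoOn x (Set.Icc (-2) ((m : ℤ) + 2)))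
    (hy : StrictMonoOn y (Set.Icc (-2) ((n : ℤ) + 2))) (i j : ℤ) :
    siteM m n x y i j ∈ Omega m n x y :=
  ⟨⟨(mid_mem hx i).1, (mid_mem hy j).1⟩, (mid_mem hx i).2, (mid_mem hy j).2⟩

theorem siteA_mem {m n : ℕ} {x y : ℤ → ℝ} (hx : StrictMonoOn x (Set.Icc (-2) ((m : ℤ) + 2)))
    (hy : StrictMonoOn y (Set.Icc (-2) ((n : ℤ) + 2))) (i j : ℤ) :
    siteA m n x y i j ∈ Omega m n x y :=
  ⟨⟨(knot_mem hx i).1, (knot_mem hy j).1⟩, (knot_mem hx i).2, (knot_mem hy j).2⟩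

theorem coeffA_add_coeffC_eq {m : ℕ} {x : ℤ → ℝ}
    (hx : StrictMonoOn x (Set.Icc (-2) ((m : ℤ) + 2))) {i : ℤ}
    (hi : i ∈ Set.Icc (1 : ℤ) m) :
    coeffA m x i + coeffC m x i = -(sigma m x i * sigma' m x (i + 1)) := by
  obtain ⟨h0, h1⟩ := hi
  have hn : ¬ (i = 0 ∨ i = m + 1) := by omega
  have h := add_pos_of_pos_of_nonneg (sigma_pos hx h0 h1) (sigma'_nonneg hx (i + 1))
  rw [coeffA, coeffC, if_neg hn, if_neg hn]
  field_simp
  ring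

theorem coeffA_nonpos {m : ℕ} {x : ℤ → ℝ} (hx : StrictMonoOn x (Set.Icc (-2) ((m : ℤ) + 2)))
    (i : ℤ) : coeffA m x i ≤ 0 := by
  have := sigma_nonneg hx i
  have := sigma'_nonneg hx (i + 1)
  unfold coeffA
  split_ifs
  · exact le_rfl
  · exact neg_nonpos.2 (by positivity)

theorem coeffC_nonpos {m : ℕ} {x : ℤ → ℝ} (hx : StrictMonoOn x (Set.Icc (-2) ((m : ℤ) + 2)))
    (i : ℤ) : coeffC m x i ≤ 0 := by
  have := sigma_nonneg hx i
  have := sigma'_nonneg hx (i + 1)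
  unfold coeffC
  split_ifs
  · exact le_rfl
  · exact neg_nonpos.2 (by positivity)

theorem neg_one_le_coeffA_add_coeffC {m : ℕ} {x : ℤ → ℝ}
    (hx : StrictMonoOn x (Set.Icc (-2) ((m : ℤ) + 2))) {i : ℤ}
    (hi : i ∈ Set.Icc (0 : ℤ) (m + 1)) : -1 ≤ coeffA m x i + coeffC m x i := by
  by_cases h : i = 0 ∨ i = m + 1
  · simp [coeffA, coeffC, h]
  · obtain ⟨h0, h1⟩ := hi
    rw [coeffA_add_coeffC_eq hx ⟨by omega, by omega⟩]
    have := mul_le_one₀ (sigma_le_one hx i) (sigma'_nonneg hx (i + 1)) (sigma'_le_one hx (i + 1))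
    linarith

/-- The one-dimensional functional with weights `a_i`, `1 - a_i - c_i`, `c_i` at the midpoints
takes the monomial `t ^ r`, `r ≤ 2`, to its B-spline coefficient. -/
theorem mid_pow_combination {m : ℕ} {x : ℤ → ℝ}
    (hx : StrictMonoOn x (Set.Icc (-2) ((m : ℤ) + 2))) {r : ℕ} (hr : r ≤ 2) {i : ℤ}
    (hi : i ∈ Set.Icc (0 : ℤ) (m + 1)) :
    mid m x i ^ r + coeffA m x i * (mid m x (i - 1) ^ r - mid m x i ^ r)
      + coeffC m x i * (mid m x (i + 1) ^ r - mid m x i ^ r) = marsden m x r i := by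
  by_cases h : i = 0 ∨ i = m + 1
  -- At the two ends the neighbouring knots coincide, so the midpoint is itself the knot and no
  -- correction is needed.
  · have hz : knot m x (i - 1) = knot m x i := by
      rcases h with rfl | rfl <;> simp [knot]
    simp only [coeffA, coeffC, h, if_true, zero_mul, add_zero, mid, marsden, hz]
    interval_cases r <;> simp [blossom]; ring
  · obtain ⟨h0, h1⟩ := hi
    have hs := add_pos_of_pos_of_nonneg (sigma_pos hx (by omega : 1 ≤ i) (by omega))
      (sigma'_nonneg hx (i + 1))
    have hp := step_pos hx (by omega : 1 ≤ i) (by omega)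
    have hl : 0 < step m x (i - 1) + step m x i :=
      add_pos_of_nonneg_of_pos (step_nonneg hx _) hp
    have hr' : 0 < step m x i + step m x (i + 1) :=
      add_pos_of_pos_of_nonneg hp (step_nonneg hx _)
    have e1 : sigma m x i * (mid m x i - mid m x (i - 1)) = step m x i / 2 := by
      have : mid m x i - mid m x (i - 1) = (step m x (i - 1) + step m x i) / 2 := by
        unfold mid step; ring
      rw [this, sigma]
      field_simp
    have e2 : sigma' m x (i + 1) * (mid m x (i + 1) - mid m x i) = step m x i / 2 := by
      have : mid m x (i + 1) - mid m x i = (step m x i + step m x (i + 1)) / 2 := by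
        unfold mid step; rw [add_sub_cancel_right]; ring
      rw [this, sigma', add_sub_cancel_right]
      field_simp
    -- The target for `t ^ 2` falls short of the squared midpoint by `(h_i / 2) ^ 2`. The weights
    -- must therefore have first moment zero (`k1`) and second moment `-(h_i / 2) ^ 2` (`k2`) about
    -- `s_i`.
    have e3 : mid m x i ^ 2 - (step m x i / 2) ^ 2 = knot m x (i - 1) * knot m x i := by
      unfold mid step; ring
    rw [coeffA, coeffC, if_neg h, if_neg h]
    set S := sigma m x i
    set S' := sigma' m x (i + 1)
    set H := step m x i / 2
    have k1 : -(S ^ 2 * S' / (S + S')) * (mid m x (i - 1) - mid m x i)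
        + -(S * S' ^ 2 / (S + S')) * (mid m x (i + 1) - mid m x i) = 0 := by
      field_simp
      linear_combination (S * S') * e1 - (S * S') * e2
    have k2 : -(S ^ 2 * S' / (S + S')) * (mid m x (i - 1) - mid m x i) ^ 2
        + -(S * S' ^ 2 / (S + S')) * (mid m x (i + 1) - mid m x i) ^ 2 = -H ^ 2 := by
      have e1' : S ^ 2 * (mid m x (i - 1) - mid m x i) ^ 2 = H ^ 2 := by rw [← e1]; ring
      have e2' : S' ^ 2 * (mid m x (i + 1) - mid m x i) ^ 2 = H ^ 2 := by rw [← e2]; ring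
      field_simp
      linear_combination -S' * e1' - S * e2'
    interval_cases r
    · simp [marsden, blossom]
    · simp only [marsden, blossom, pow_one]
      simp only [one_ne_zero, if_false, if_true]
      rw [← mid]
      linear_combination k1
    · simp only [marsden, blossom]
      norm_num only [if_false]
      rw [← e3]
      linear_combination k2 + 2 * mid m x i * k1

/-- The sites form a cross, so a pure power sees only one direction, and for the product of the
coordinates both corrections are first moments, which vanish. -/
theorem mu_monomial {m n : ℕ} {x y : ℤ → ℝ}
    (hx : StrictMonoOn x (Set.Icc (-2) ((m : ℤ) + 2)))
    (hy : StrictMonoOn y (Set.Icc (-2) ((n : ℤ) + 2))) {i j : ℤ}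
    (hi : i ∈ Set.Icc (0 : ℤ) (m + 1)) (hj : j ∈ Set.Icc (0 : ℤ) (n + 1)) {r s : ℕ}
    (hrs : r + s ≤ 2) :
    muLin m n x y i j (fun Q => Q.1 ^ r * Q.2 ^ s) = marsden m x r i * marsden n y s j := by
  change mu m n x y i j (fun Q => Q.1 ^ r * Q.2 ^ s) = _
  have h0 : ∀ (m : ℕ) (x : ℤ → ℝ) (i : ℤ), marsden m x 0 i = 1 := fun _ _ _ => rfl
  have h1 : ∀ (m : ℕ) (x : ℤ → ℝ) (i : ℤ), marsden m x 1 i = mid m x i := fun _ _ _ => rfl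
  have ex := fun r hr => mid_pow_combination hx (r := r) hr hi
  have ey := fun r hr => mid_pow_combination hy (r := r) hr hj
  have ex1 := ex 1 (by norm_num)
  have ex2 := ex 2 le_rfl
  have ey1 := ey 1 (by norm_num)
  have ey2 := ey 2 le_rfl
  have : r ≤ 2 := by omega
  have : s ≤ 2 := by omega
  simp only [mu, siteM, coeffB]
  interval_cases r <;> interval_cases s <;> first | omega | skip
  · simp only [h0]; ring
  · simp only [h0]; linear_combination ey1
  · simp only [h0]; linear_combination ey2
  · simp only [h0]; linear_combination ex1
  · simp only [h1] at *; linear_combination mid n y j * ex1 + mid m x i * ey1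
  · simp only [h0]; linear_combination ex2

/-- For squares, `(p + q) ^ 2 / 2 - (p ^ 2 + q ^ 2) / 2 = p * q`; for functions affine in each
variable the corner mean equals the centre value. -/
theorem muStar_monomial {m n : ℕ} (x y : ℤ → ℝ) (i j : ℤ) {r s : ℕ} (hrs : r + s ≤ 2) :
    muStarLin m n x y i j (fun Q => Q.1 ^ r * Q.2 ^ s) = marsden m x r i * marsden n y s j := by
  change muStar m n x y i j (fun Q => Q.1 ^ r * Q.2 ^ s) = _
  have : r ≤ 2 := by omega
  have : s ≤ 2 := by omega
  simp only [muStar, siteM, siteA, mid, marsden]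
  interval_cases r <;> interval_cases s <;> first | omega | (simp [blossom]; try ring)

theorem abs_mu_le {m n : ℕ} {x y : ℤ → ℝ}
    (hx : StrictMonoOn x (Set.Icc (-2) ((m : ℤ) + 2)))
    (hy : StrictMonoOn y (Set.Icc (-2) ((n : ℤ) + 2))) {i j : ℤ}
    (hi : i ∈ Set.Icc (0 : ℤ) (m + 1)) (hj : j ∈ Set.Icc (0 : ℤ) (n + 1)) {f : ℝ × ℝ → ℝ} {M : ℝ}
    (hf : ∀ Q ∈ Omega m n x y, |f Q| ≤ M) : |muLin m n x y i j f| ≤ 5 * M := by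
  change |mu m n x y i j f| ≤ _
  have hs := fun i j => hf _ (siteM_mem hx hy i j)
  have hM : 0 ≤ M := (abs_nonneg _).trans (hs 0 0)
  have bound : ∀ c i j, |c * f (siteM m n x y i j)| ≤ |c| * M := fun c i j => by
    rw [abs_mul]; exact mul_le_mul_of_nonneg_left (hs i j) (abs_nonneg c)
  have tri : ∀ p q s t w : ℝ, |p + q + s + t + w| ≤ |p| + |q| + |s| + |t| + |w| :=
    fun p q s t w => (abs_add_le _ _).trans (add_le_add_left ((abs_add_le _ _).trans
      (add_le_add_left ((abs_add_le _ _).trans (add_le_add_left (abs_add_le _ _) _)) _)) _)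
  have a1 := coeffA_nonpos hx i
  have a2 := coeffC_nonpos hx i
  have a3 := coeffA_nonpos hy j
  have a4 := coeffC_nonpos hy j
  have s1 := neg_one_le_coeffA_add_coeffC hx hi
  have s2 := neg_one_le_coeffA_add_coeffC hy hj
  refine (tri _ _ _ _ _).trans ((add_le_add (add_le_add (add_le_add (add_le_add (bound _ _ _)
    (bound _ _ _)) (bound _ _ _)) (bound _ _ _)) (bound _ _ _)).trans ?_)
  rw [← add_mul, ← add_mul, ← add_mul, ← add_mul]
  refine mul_le_mul_of_nonneg_right ?_ hM
  -- With `b ≥ 0` and the other weights non-positive, the absolute weights add up to `1 - 2 (a + c +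
  -- ā + c̄) ≤ 5`.
  have hb : 0 ≤ coeffB m n x y i j := by unfold coeffB; linarith
  rw [abs_of_nonneg hb, abs_of_nonpos a1, abs_of_nonpos a2, abs_of_nonpos a3, abs_of_nonpos a4]
  unfold coeffB
  linarith

theorem abs_muStar_le {m n : ℕ} {x y : ℤ → ℝ}
    (hx : StrictMonoOn x (Set.Icc (-2) ((m : ℤ) + 2)))
    (hy : StrictMonoOn y (Set.Icc (-2) ((n : ℤ) + 2))) (i j : ℤ) {f : ℝ × ℝ → ℝ} {M : ℝ}
    (hf : ∀ Q ∈ Omega m n x y, |f Q| ≤ M) : |muStarLin m n x y i j f| ≤ 3 * M := by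
  change |muStar m n x y i j f| ≤ _
  have h0 := abs_le.1 (hf _ (siteM_mem hx hy i j))
  have h1 := abs_le.1 (hf _ (siteA_mem hx hy (i - 1) (j - 1)))
  have h2 := abs_le.1 (hf _ (siteA_mem hx hy (i - 1) j))
  have h3 := abs_le.1 (hf _ (siteA_mem hx hy i (j - 1)))
  have h4 := abs_le.1 (hf _ (siteA_mem hx hy i j))
  unfold muStar
  rw [abs_le]
  constructor <;> linarith

/-! ### Spline operators -/

/-- Functionals that reproduce the coefficients of the quadratic monomials give an operator that
reproduces quadratic polynomials. -/
theorem sum_functional_mul_bspline_polynomial {m n : ℕ} (hm : 1 ≤ m) (hn : 1 ≤ n) {x y : ℤ → ℝ}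
    (hx : StrictMonoOn x (Set.Icc (-2) ((m : ℤ) + 2)))
    (hy : StrictMonoOn y (Set.Icc (-2) ((n : ℤ) + 2))) (ν : ℤ → ℤ → (ℝ × ℝ → ℝ) →ₗ[ℝ] ℝ)
    (hν : ∀ i ∈ Set.Icc (0 : ℤ) (m + 1), ∀ j ∈ Set.Icc (0 : ℤ) (n + 1), ∀ r s : ℕ, r + s ≤ 2 →
      ν i j (fun Q => Q.1 ^ r * Q.2 ^ s) = marsden m x r i * marsden n y s j)
    {p : MvPolynomial (Fin 2) ℝ} (hp : p.totalDegree ≤ 2) {P : ℝ × ℝ} (hP : P ∈ Omega m n x y) :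
    ∑ i ∈ Finset.Icc (0 : ℤ) (m + 1), ∑ j ∈ Finset.Icc (0 : ℤ) (n + 1),
      ν i j (fun Q => MvPolynomial.eval ![Q.1, Q.2] p) * bspline m n x y i j P
        = MvPolynomial.eval ![P.1, P.2] p := by
  have heval : ∀ Q : ℝ × ℝ, MvPolynomial.eval ![Q.1, Q.2] p
      = ∑ d ∈ p.support, p.coeff d * (Q.1 ^ d 0 * Q.2 ^ d 1) := fun Q => by
    simp [MvPolynomial.eval_eq', Fin.prod_univ_two]
  have hdeg : ∀ d ∈ p.support, d 0 + d 1 ≤ 2 := fun d hd => by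
    have := (MvPolynomial.le_totalDegree hd).trans hp
    rwa [Finsupp.sum_fintype _ _ fun _ => rfl, Fin.sum_univ_two] at this
  have hlin : ∀ i ∈ Finset.Icc (0 : ℤ) (m + 1), ∀ j ∈ Finset.Icc (0 : ℤ) (n + 1),
      ν i j (fun Q => MvPolynomial.eval ![Q.1, Q.2] p)
        = ∑ d ∈ p.support, p.coeff d * (marsden m x (d 0) i * marsden n y (d 1) j) := by
    intro i hi j hj
    have hfun : (fun Q : ℝ × ℝ => MvPolynomial.eval ![Q.1, Q.2] p)
        = ∑ d ∈ p.support, p.coeff d • fun Q : ℝ × ℝ => Q.1 ^ d 0 * Q.2 ^ d 1 := by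
      ext Q
      simp [heval]
    rw [hfun, map_sum]
    refine Finset.sum_congr rfl fun d hd => ?_
    rw [map_smul, hν i (Finset.mem_Icc.1 hi) j (Finset.mem_Icc.1 hj) _ _ (hdeg d hd), smul_eq_mul]
  rw [Finset.sum_congr rfl fun i hi => Finset.sum_congr rfl fun j hj => by
    rw [hlin i hi j hj, Finset.sum_mul]]
  rw [Finset.sum_congr rfl fun i _ => Finset.sum_comm, Finset.sum_comm, heval]
  refine Finset.sum_congr rfl fun d hd => ?_
  rw [← sum_marsden_mul_bspline hm hn hx hy (hdeg d hd) hP]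
  simp only [Finset.mul_sum, mul_assoc]

/-- The operator `f ↦ ∑ ν_k(f) B_k` given by a non-negative partition of unity and functionals
of norm at most `C` has norm at most `C`. -/
theorem exists_clm_of_partitionOfUnity {X ι : Type*} [TopologicalSpace X] {Ω : Set X}
    [CompactSpace Ω] (K : Finset ι) (ν : ι → (X → ℝ) →ₗ[ℝ] ℝ) (B : ι → X → ℝ) {C : ℝ}
    (hC : 0 ≤ C) (hcont : ∀ k ∈ K, ContinuousOn (B k) Ω) (hB : ∀ k ∈ K, ∀ P ∈ Ω, 0 ≤ B k P)
    (hsum : ∀ P ∈ Ω, ∑ k ∈ K, B k P = 1)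
    (hν : ∀ k ∈ K, ∀ (f : X → ℝ) (M : ℝ), (∀ Q ∈ Ω, |f Q| ≤ M) → |ν k f| ≤ C * M) :
    ∃ L : C(Ω, ℝ) →L[ℝ] C(Ω, ℝ),
      (∀ (f : X → ℝ) (hf : ContinuousOn f Ω) (P : Ω),
        L ⟨Ω.domRestrict f, hf.domRestrict⟩ P = ∑ k ∈ K, ν k f * B k P) ∧ ‖L‖ ≤ C := by
  classical
  -- The functionals act on functions on all of `X`, so elements of `C(Ω, ℝ)` are extended by `0`;
  -- continuity of the extension is not needed.
  let ext : C(Ω, ℝ) →ₗ[ℝ] X → ℝ :=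
    { toFun := fun g Q => if h : Q ∈ Ω then g ⟨Q, h⟩ else 0
      map_add' := fun f g => by ext Q; by_cases h : Q ∈ Ω <;> simp [h]
      map_smul' := fun c f => by ext Q; by_cases h : Q ∈ Ω <;> simp [h] }
  have hext : ∀ (g : C(Ω, ℝ)) (P : Ω), ext g P = g P := fun g P => by simp [ext]
  let T : C(Ω, ℝ) →ₗ[ℝ] C(Ω, ℝ) :=
    { toFun := fun g => ⟨fun P => ∑ k ∈ K, ν k (ext g) * B k P,
        continuous_finsetSum _ fun k hk => continuous_const.mul (hcont k hk).domRestrict⟩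
      map_add' := fun f g => by ext P; simp [add_mul, Finset.sum_add_distrib]
      map_smul' := fun c f => by ext P; simp [mul_assoc, Finset.mul_sum] }
  have hT : ∀ g P, T g P = ∑ k ∈ K, ν k (ext g) * B k P := fun _ _ => rfl
  have hbound : ∀ g, ‖T g‖ ≤ C * ‖g‖ := by
    intro g
    refine (ContinuousMap.norm_le _ (by positivity)).2 fun P => ?_
    rw [hT, Real.norm_eq_abs]
    have hg : ∀ Q ∈ Ω, |ext g Q| ≤ ‖g‖ := fun Q hQ => by
      rw [hext g ⟨Q, hQ⟩]; exact g.norm_coe_le_norm _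
    calc |∑ k ∈ K, ν k (ext g) * B k P|
        ≤ ∑ k ∈ K, |ν k (ext g) * B k P| := Finset.abs_sum_le_sum_abs _ _
      _ ≤ ∑ k ∈ K, C * ‖g‖ * B k P := Finset.sum_le_sum fun k hk => by
          rw [abs_mul, abs_of_nonneg (hB k hk P P.2)]
          exact mul_le_mul_of_nonneg_right (hν k hk _ _ hg) (hB k hk P P.2)
      _ = C * ‖g‖ := by rw [← Finset.mul_sum, hsum P P.2, mul_one]
  refine ⟨T.mkContinuous C hbound, fun f hf P => ?_, T.mkContinuous_norm_le hC hbound⟩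
  rw [LinearMap.mkContinuous_apply, hT]
  refine Finset.sum_congr rfl fun k hk => ?_
  congr 1
  -- The bound `hν` with `M = 0` shows that a functional ignores values outside `Ω`, so `f` and the
  -- zero extension of its restriction give the same result.
  rw [← sub_eq_zero, ← map_sub, ← abs_nonpos_iff]
  refine (hν k hk _ 0 fun Q hQ => ?_).trans_eq (mul_zero C)
  rw [Pi.sub_apply, hext _ ⟨Q, hQ⟩]
  simp

theorem exists_clm_of_functionals {m n : ℕ} (hm : 1 ≤ m) (hn : 1 ≤ n) {x y : ℤ → ℝ}
    (hx : StrictMonoOn x (Set.Icc (-2) ((m : ℤ) + 2)))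
    (hy : StrictMonoOn y (Set.Icc (-2) ((n : ℤ) + 2))) (ν : ℤ → ℤ → (ℝ × ℝ → ℝ) →ₗ[ℝ] ℝ) {C : ℝ}
    (hC : 0 ≤ C)
    (hν : ∀ i ∈ Set.Icc (0 : ℤ) (m + 1), ∀ j ∈ Set.Icc (0 : ℤ) (n + 1), ∀ (f : ℝ × ℝ → ℝ) (M : ℝ),
      (∀ Q ∈ Omega m n x y, |f Q| ≤ M) → |ν i j f| ≤ C * M) :
    ∃ L : C(Omega m n x y, ℝ) →L[ℝ] C(Omega m n x y, ℝ),
      (∀ (f : ℝ × ℝ → ℝ) (hf : ContinuousOn f (Omega m n x y)) (P : Omega m n x y),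
        L ⟨(Omega m n x y).domRestrict f, hf.domRestrict⟩ P
          = ∑ i ∈ Finset.Icc (0 : ℤ) (m + 1), ∑ j ∈ Finset.Icc (0 : ℤ) (n + 1),
            ν i j f * bspline m n x y i j P) ∧ ‖L‖ ≤ C := by
  have hmem : ∀ k ∈ Finset.Icc (0 : ℤ) (m + 1) ×ˢ Finset.Icc (0 : ℤ) (n + 1),
      k.1 ∈ Set.Icc (0 : ℤ) (m + 1) ∧ k.2 ∈ Set.Icc (0 : ℤ) (n + 1) := fun k hk =>
    ⟨Finset.mem_Icc.1 (Finset.mem_product.1 hk).1, Finset.mem_Icc.1 (Finset.mem_product.1 hk).2⟩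
  obtain ⟨L, hL, hnorm⟩ := exists_clm_of_partitionOfUnity (Ω := Omega m n x y)
    (Finset.Icc (0 : ℤ) (m + 1) ×ˢ Finset.Icc (0 : ℤ) (n + 1)) (fun k => ν k.1 k.2)
    (fun k => bspline m n x y k.1 k.2) hC
    (fun k hk => continuousOn_bspline hm hn hx hy (hmem k hk).1 (hmem k hk).2)
    (fun k hk P hP => bspline_nonneg hm hn hx hy (hmem k hk).1 (hmem k hk).2 hP)
    (fun P hP => by
      have := sum_marsden_mul_bspline hm hn hx hy (r := 0) (s := 0) (by norm_num) hP
      rw [Finset.sum_product]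
      simpa [marsden, blossom] using this)
    (fun k hk => hν _ (hmem k hk).1 _ (hmem k hk).2)
  refine ⟨L, fun f hf P => ?_, hnorm⟩
  rw [hL f hf, Finset.sum_product]

end CrissCross

end

theorem mainTheorem4 (m n : ℕ) (hm : 1 ≤ m) (hn : 1 ≤ n) (x y : ℤ → ℝ)
    (hx : StrictMonoOn x (Set.Icc (-2) ((m : ℤ) + 2)))
    (hy : StrictMonoOn y (Set.Icc (-2) ((n : ℤ) + 2))) :
    -- all data sites lie in the rectangle
    (∀ i ∈ Set.Icc (0 : ℤ) (m + 1), ∀ j ∈ Set.Icc (0 : ℤ) (n + 1),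
      CrissCross.siteM m n x y i j ∈ CrissCross.Omega m n x y) ∧
    (∀ i ∈ Set.Icc (-1 : ℤ) (m + 1), ∀ j ∈ Set.Icc (-1 : ℤ) (n + 1),
      CrissCross.siteA m n x y i j ∈ CrissCross.Omega m n x y) ∧
    -- exactness on polynomials of total degree at most two
    (∀ p : MvPolynomial (Fin 2) ℝ, p.totalDegree ≤ 2 →
      ∀ P ∈ CrissCross.Omega m n x y,
        CrissCross.S2 m n x y (fun Q => MvPolynomial.eval ![Q.1, Q.2] p) P
            = MvPolynomial.eval ![P.1, P.2] p ∧
          CrissCross.W2star m n x y (fun Q => MvPolynomial.eval ![Q.1, Q.2] p) P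
            = MvPolynomial.eval ![P.1, P.2] p) ∧
    -- the operators act on continuous functions on the rectangle, with norms at most 5 and 3
    (∃ L : C(CrissCross.Omega m n x y, ℝ) →L[ℝ] C(CrissCross.Omega m n x y, ℝ),
      (∀ (f : ℝ × ℝ → ℝ) (hf : ContinuousOn f (CrissCross.Omega m n x y))
        (P : CrissCross.Omega m n x y),
        L ⟨(CrissCross.Omega m n x y).domRestrict f, hf.domRestrict⟩ P
          = CrissCross.S2 m n x y f P) ∧ ‖L‖ ≤ 5) ∧
    (∃ L : C(CrissCross.Omega m n x y, ℝ) →L[ℝ] C(CrissCross.Omega m n x y, ℝ),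
      (∀ (f : ℝ × ℝ → ℝ) (hf : ContinuousOn f (CrissCross.Omega m n x y))
        (P : CrissCross.Omega m n x y),
        L ⟨(CrissCross.Omega m n x y).domRestrict f, hf.domRestrict⟩ P
          = CrissCross.W2star m n x y f P) ∧ ‖L‖ ≤ 3) := by
  open CrissCross in
  refine ⟨fun i _ j _ => siteM_mem hx hy i j, fun i _ j _ => siteA_mem hx hy i j,
    fun p hp P hP => ⟨?_, ?_⟩, ?_, ?_⟩
  · exact sum_functional_mul_bspline_polynomial hm hn hx hy (muLin m n x y)
      (fun i hi j hj r s hrs => mu_monomial hx hy hi hj hrs) hp hP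
  · exact sum_functional_mul_bspline_polynomial hm hn hx hy (muStarLin m n x y)
      (fun i _ j _ r s hrs => muStar_monomial x y i j hrs) hp hP
  · exact exists_clm_of_functionals hm hn hx hy (muLin m n x y) (by norm_num)
      fun i hi j hj f M hf => abs_mu_le hx hy hi hj hf
  · exact exists_clm_of_functionals hm hn hx hy (muStarLin m n x y) (by norm_num)
      fun i _ j _ f M hf => abs_muStar_le hx hy i j hf
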